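/- Let $N\ge 2$ and $K\ge 1$. Let $\mu_{N,K}$ be the induced measure on the set of density matrices of order $N$ (positive semidefinite complex $N\times N$ matrices of trace $1$), i.e. the law of $\sigma=\mathrm{Tr}_{K}|\xi\rangle\langle\xi|$, where $|\xi\rangle\in\mathbb C^N\otimes\mathbb C^K$ is a random pure state (a uniformly distributed unit vector) and $\mathrm{Tr}_K$ is the partial trace over the $K$-dimensional factor. The numerical shadow of a random matrix $\sigma$ is the law on $\mathbb C$ of the expectation value $\langle x|\sigma|x\rangle$, where $|x\rangle\in\mathbb C^N$ is a random pure state (a uniformly distributed unit vector) independent of $\sigma$. If $\sigma$ is distributed according to $\mu_{N,K}$, then its numerical shadow is the Beta distribution with parameters $\{K, K(N-1)\}$, supported on $[0,1]\subset\mathbb C$; explicitly, it has on $[0,1]$ the density $$P_\sigma(r)=\frac{1}{B(K,K(N-1))}\, r^{K-1}(1-r)^{K(N-1)-1},\qquad 0\le r\le 1,$$ where $B$ is the Beta function. Moreover, for every $i=1,\dots,N$, the diagonal entry $\sigma_{ii}$ has this same distribution. -/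

import Mathlib

open MeasureTheory
open scoped ComplexOrder

noncomputable section

/-- The Borel σ-algebra on complex matrices (the product σ-algebra of the entries). -/
instance Matrix.instMeasurableSpaceComplex {m n : Type*} : MeasurableSpace (Matrix m n ℂ) :=
  inferInstanceAs (MeasurableSpace (m → n → ℂ))

/-- Unit vectors of the Hilbert space `ℂ^ι`; they represent pure states up to a phase. -/
abbrev UnitVector (ι : Type*) [Fintype ι] : Type _ :=
  Metric.sphere (0 : EuclideanSpace ℂ ι) 1

/-- The law of a random pure state: the uniform (normalised surface) probability measure on the
unit sphere of `ℂ^ι`. The Fubini-Study measure on the projective space is its image under the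
quotient by phases, and all the quantities considered below (projectors and expectation values)
do not depend on the phase. -/
def randomPureState (ι : Type*) [Fintype ι] : Measure (UnitVector ι) :=
  ((volume : Measure (EuclideanSpace ℂ ι)).toSphere Set.univ)⁻¹ •
    (volume : Measure (EuclideanSpace ℂ ι)).toSphere

instance randomPureState.instIsProbabilityMeasure (ι : Type*) [Fintype ι] [Nonempty ι] :
    IsProbabilityMeasure (randomPureState ι) where
  measure_univ := by
    rw [randomPureState, Measure.smul_apply, smul_eq_mul]
    refine ENNReal.inv_mul_cancel ?_ (measure_ne_top _ _)
    rw [Ne, Measure.measure_univ_eq_zero]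
    exact Measure.toSphere_ne_zero _

instance randomPureState.instIsFiniteMeasure (ι : Type*) [Fintype ι] :
    IsFiniteMeasure (randomPureState ι) where
  measure_univ_lt_top := by
    rw [randomPureState, Measure.smul_apply, smul_eq_mul]
    exact lt_of_le_of_lt (ENNReal.inv_mul_le_one _) ENNReal.one_lt_top

/-- The set of mixed states (density matrices) on `ℂ^ι`. -/
abbrev DensityMatrix (ι : Type*) [Fintype ι] : Type _ :=
  {ρ : Matrix ι ι ℂ // ρ.PosSemidef ∧ ρ.trace = 1}

/-- The projector `|ψ⟩⟨ψ|`. -/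
def pureProjector {ι : Type*} [Fintype ι] (ψ : UnitVector ι) : Matrix ι ι ℂ :=
  Matrix.vecMulVec (fun i => ψ.1 i) (star fun i => ψ.1 i)

/-- The partial trace over the second factor of `ℂ^ι ⊗ ℂ^κ = ℂ^(ι × κ)`. -/
def partialTrace {ι κ : Type*} [Fintype κ] (ρ : Matrix (ι × κ) (ι × κ) ℂ) : Matrix ι ι ℂ :=
  Matrix.of fun i j => ∑ k, ρ (i, k) (j, k)

theorem partialTrace_pureProjector_posSemidef {ι κ : Type*} [Fintype ι] [Fintype κ]
    (ξ : UnitVector (ι × κ)) : (partialTrace (pureProjector ξ)).PosSemidef := by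
  have h : partialTrace (pureProjector ξ) =
      (Matrix.of fun i k => ξ.1 (i, k)) * (Matrix.of fun i k => ξ.1 (i, k)).conjTranspose := by
    ext i j
    simp [partialTrace, pureProjector, Matrix.mul_apply, Matrix.vecMulVec_apply]
  rw [h]
  exact Matrix.posSemidef_self_mul_conjTranspose _

theorem partialTrace_pureProjector_trace {ι κ : Type*} [Fintype ι] [Fintype κ]
    (ξ : UnitVector (ι × κ)) : (partialTrace (pureProjector ξ)).trace = 1 := by
  have h1 : ‖ξ.1‖ = 1 := by simp
  have h2 := EuclideanSpace.norm_sq_eq ξ.1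
  rw [h1, Fintype.sum_prod_type] at h2
  simp only [partialTrace, pureProjector, Matrix.trace, Matrix.diag, Matrix.of_apply,
    Matrix.vecMulVec_apply, Pi.star_apply, RCLike.star_def, Complex.mul_conj']
  norm_cast
  rw [← h2]
  norm_num

/-- The mixed state `Tr_κ |ξ⟩⟨ξ|` of a bipartite pure state `ξ`. -/
def reducedState {ι κ : Type*} [Fintype ι] [Fintype κ] (ξ : UnitVector (ι × κ)) :
    DensityMatrix ι :=
  ⟨partialTrace (pureProjector ξ), partialTrace_pureProjector_posSemidef ξ,
    partialTrace_pureProjector_trace ξ⟩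

theorem measurable_reducedState {ι κ : Type*} [Fintype ι] [Fintype κ] :
    Measurable (reducedState : UnitVector (ι × κ) → DensityMatrix ι) := by
  refine Measurable.subtype_mk ?_
  refine measurable_pi_iff.2 fun i => measurable_pi_iff.2 fun j => ?_
  change Measurable fun ξ : UnitVector (ι × κ) => ∑ k, ξ.1 (i, k) * star (ξ.1 (j, k))
  exact Continuous.measurable (by fun_prop)

/-- The induced measure `μ_{N,K}` on density matrices of order `N`: the law of the partial trace
over the `K`-dimensional factor of a random pure state on `ℂ^N ⊗ ℂ^K`. -/
def inducedMeasure (N K : ℕ) : Measure (DensityMatrix (Fin N)) :=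
  (randomPureState (Fin N × Fin K)).map reducedState

/-- The expectation value `⟨ψ|A|ψ⟩`. -/
def expectationValue {ι : Type*} [Fintype ι] (A : Matrix ι ι ℂ) (ψ : UnitVector ι) : ℂ :=
  dotProduct (star fun i => ψ.1 i) (A.mulVec fun i => ψ.1 i)

theorem measurable_expectationValue {ι : Type*} [Fintype ι] :
    Measurable fun p : Matrix ι ι ℂ × UnitVector ι => expectationValue p.1 p.2 := by
  simp only [expectationValue, dotProduct, Matrix.mulVec, Pi.star_apply]
  have hA : ∀ i j, Measurable fun p : Matrix ι ι ℂ × UnitVector ι => p.1 i j := fun i j =>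
    (measurable_pi_apply j).comp ((measurable_pi_apply i).comp measurable_fst)
  have hψ : ∀ i, Measurable fun p : Matrix ι ι ℂ × UnitVector ι => p.2.1 i := fun i =>
    (Continuous.measurable (f := fun ψ : UnitVector ι => ψ.1 i) (by fun_prop)).comp measurable_snd
  refine Finset.measurable_sum _ fun i _ => Measurable.mul ?_ ?_
  · exact continuous_star.measurable.comp (hψ i)
  · exact Finset.measurable_sum _ fun j _ => (hA i j).mul (hψ j)

/-- The numerical shadow of a fixed matrix `A`: the law of `⟨x|A|x⟩` for a random pure
state `x`. -/
def numericalShadow {ι : Type*} [Fintype ι] (A : Matrix ι ι ℂ) : Measure ℂ :=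
  (randomPureState ι).map (expectationValue A)

/-- The numerical shadow of a random matrix with law `μ`: the law of `⟨x|A|x⟩`, where `A` has law
`μ` and `x` is a random pure state independent of `A`. -/
def randomNumericalShadow {ι : Type*} [Fintype ι] (μ : Measure (Matrix ι ι ℂ)) : Measure ℂ :=
  (μ.prod (randomPureState ι)).map fun p => expectationValue p.1 p.2

theorem map_prod_apply_eq_lintegral {α β γ : Type*} [MeasurableSpace α] [MeasurableSpace β]
    [MeasurableSpace γ] (μ : Measure α) (ν : Measure β) [SFinite ν] {f : α → β → γ}
    (hf : Measurable fun p : α × β => f p.1 p.2) {S : Set γ} (hS : MeasurableSet S) :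
    (μ.prod ν).map (fun p => f p.1 p.2) S = ∫⁻ a, ν.map (f a) S ∂μ := by
  rw [Measure.map_apply hf hS, Measure.prod_apply (hf hS)]
  refine lintegral_congr fun a => ?_
  have ha : Measurable (f a) := hf.comp measurable_prodMk_left
  exact (Measure.map_apply ha hS).symm

/-- The numerical shadow of a random matrix is the average of the shadows of its values. -/
theorem randomNumericalShadow_apply {ι : Type*} [Fintype ι] (μ : Measure (Matrix ι ι ℂ))
    {S : Set ℂ} (hS : MeasurableSet S) :
    randomNumericalShadow μ S = ∫⁻ A, numericalShadow A S ∂μ :=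
  map_prod_apply_eq_lintegral μ (randomPureState ι) measurable_expectationValue hS

end

/-!
The expectation value `⟨x|σ|x⟩` of `σ = Tr_κ |ξ⟩⟨ξ|` is the squared norm of the orthogonal
projection of `ξ` onto the copy `x ⊗ ℂ^κ` of `ℂ^κ` inside `ℂ^(ι × κ)`
(`expectationValue_reducedState`). So for each fixed `x` the question is how much of the squared
norm of a uniform unit vector lies in a given complex subspace. The answer depends only on
dimensions, hence not on `x`, and averaging over an independent `x` changes nothing. The diagonal
entries are the case where `x` is a basis vector.

The law of this proportion is found in `map_toSphere_norm_sq_fst`. It is also the law of the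
proportion for a uniform point of the unit ball, because the proportion is scale invariant
(`toSphere_preimage_eq`). Haar measure on the whole space is, up to a constant, the product of Haar
measures on the subspace and its complement, and on a space of real dimension `2 (p + 1)` the squared
norm has density proportional to `a ^ p` (`exists_lintegral_norm_sq_eq`). What remains is the
classical substitution `s = a + b`, `r = a / (a + b)` in
`∫∫ a ^ p * b ^ q * w (a + b) * φ (a / (a + b))`, which splits off the Beta density in `r`
(`lintegral_lintegral_halfLinePow`). No constant has to be computed along the way, since both
sides are probability measures.
-/

open Set Metric Module ProbabilityTheory
open scoped ENNReal InnerProductSpace Pointwise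

/-! ### The Beta integral on the half-line -/

/-- The function `x ↦ x ^ p` on the open half-line, extended by zero. -/
noncomputable def halfLinePow (p : ℕ) : ℝ → ℝ≥0∞ :=
  (Ioi 0).indicator fun x => ENNReal.ofReal (x ^ p)

theorem measurable_halfLinePow (p : ℕ) : Measurable (halfLinePow p) :=
  Measurable.indicator (by fun_prop) measurableSet_Ioi

theorem halfLinePow_of_pos {p : ℕ} {x : ℝ} (hx : 0 < x) :
    halfLinePow p x = ENNReal.ofReal (x ^ p) :=
  indicator_of_mem (mem_Ioi.2 hx) _

theorem halfLinePow_of_nonpos {p : ℕ} {x : ℝ} (hx : x ≤ 0) : halfLinePow p x = 0 :=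
  indicator_of_notMem (by simpa using hx) _

theorem lintegral_halfLinePow_mul (p : ℕ) (g : ℝ → ℝ≥0∞) :
    ∫⁻ x, halfLinePow p x * g x = ∫⁻ x in Ioi 0, ENNReal.ofReal (x ^ p) * g x := by
  rw [← lintegral_indicator measurableSet_Ioi]
  refine lintegral_congr fun x => ?_
  by_cases hx : x ∈ Ioi (0 : ℝ) <;> simp [halfLinePow, hx]

/-- The dilation `a = s * r` turns the convolution integral at `s` of `halfLinePow p` and
`halfLinePow q`, with a weight depending on `a / s`, into a power of `s` times a Beta integral. -/
theorem lintegral_halfLinePow_mul_halfLinePow_sub (p q : ℕ) {s : ℝ} (hs : 0 < s)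
    (φ : ℝ → ℝ≥0∞) :
    ∫⁻ a, halfLinePow p a * halfLinePow q (s - a) * φ (a / s) =
      ENNReal.ofReal (s ^ (p + q + 1)) *
        ∫⁻ r, halfLinePow p r * halfLinePow q (1 - r) * φ r := by
  have key := lintegral_image_eq_lintegral_abs_deriv_mul (s := univ) (f := fun r : ℝ => s * r)
    (f' := fun _ => s) MeasurableSet.univ
    (fun x _ => (hasDerivAt_const_mul s).hasDerivWithinAt)
    (fun x _ y _ h => mul_left_cancel₀ hs.ne' h)
    (fun a => halfLinePow p a * halfLinePow q (s - a) * φ (a / s))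
  have himg : (fun r : ℝ => s * r) '' univ = univ := by
    rw [image_univ, range_eq_univ]
    exact mul_left_surjective₀ hs.ne'
  rw [himg, Measure.restrict_univ] at key
  rw [key, ← lintegral_const_mul' _ _ ENNReal.ofReal_ne_top]
  refine lintegral_congr fun r => ?_
  rw [mul_div_cancel_left₀ r hs.ne', abs_of_pos hs]
  rcases le_or_gt r 0 with hr | hr
  · rw [halfLinePow_of_nonpos (mul_nonpos_of_nonneg_of_nonpos hs.le hr),
      halfLinePow_of_nonpos hr]
    simp
  rcases le_or_gt (1 - r) 0 with hr' | hr'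
  · rw [show s - s * r = s * (1 - r) by ring,
      halfLinePow_of_nonpos (mul_nonpos_of_nonneg_of_nonpos hs.le hr'),
      halfLinePow_of_nonpos hr']
    simp
  rw [show s - s * r = s * (1 - r) by ring, halfLinePow_of_pos (mul_pos hs hr),
    halfLinePow_of_pos (mul_pos hs hr'), halfLinePow_of_pos hr, halfLinePow_of_pos hr',
    ← mul_assoc, ← mul_assoc, ← ENNReal.ofReal_mul (by positivity),
    ← ENNReal.ofReal_mul (by positivity), ← ENNReal.ofReal_mul (by positivity), ← mul_assoc,
    ← ENNReal.ofReal_mul (by positivity)]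
  congr 2
  rw [mul_pow, mul_pow]
  ring

/-- The substitution `(a, b) ↦ (a + b, a / (a + b))` separates the total `a + b` from the
proportion `a / (a + b)`. -/
theorem lintegral_lintegral_halfLinePow (p q : ℕ) {w φ : ℝ → ℝ≥0∞} (hw : Measurable w)
    (hφ : Measurable φ) :
    ∫⁻ a, halfLinePow p a * ∫⁻ b, halfLinePow q b * (w (a + b) * φ (a / (a + b))) =
      (∫⁻ s, halfLinePow (p + q + 1) s * w s) *
        ∫⁻ r, halfLinePow p r * halfLinePow q (1 - r) * φ r := by
  have hp := measurable_halfLinePow p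
  have hq := measurable_halfLinePow q
  have hpq := measurable_halfLinePow (p + q + 1)
  calc
    _ = ∫⁻ a, ∫⁻ s, w s * (halfLinePow p a * halfLinePow q (s - a) * φ (a / s)) := by
      refine lintegral_congr fun a => ?_
      rw [← lintegral_const_mul _ (by fun_prop),
        ← lintegral_add_left_eq_self
          (fun s => w s * (halfLinePow p a * halfLinePow q (s - a) * φ (a / s))) a]
      refine lintegral_congr fun b => ?_
      rw [add_sub_cancel_left]
      ring
    _ = ∫⁻ s, ∫⁻ a, w s * (halfLinePow p a * halfLinePow q (s - a) * φ (a / s)) :=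
      lintegral_lintegral_swap (by
        refine Measurable.aemeasurable ?_
        simp only [Function.uncurry_def]
        fun_prop)
    _ = ∫⁻ s, halfLinePow (p + q + 1) s * w s *
          ∫⁻ r, halfLinePow p r * halfLinePow q (1 - r) * φ r := by
      refine lintegral_congr fun s => ?_
      rw [lintegral_const_mul _ (by fun_prop)]
      rcases le_or_gt s 0 with hs | hs
      · rw [halfLinePow_of_nonpos hs]
        have : ∀ a, halfLinePow p a * halfLinePow q (s - a) * φ (a / s) = 0 := fun a => by
          rcases le_or_gt a 0 with ha | ha
          · simp [halfLinePow_of_nonpos ha]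
          · simp [halfLinePow_of_nonpos (show s - a ≤ 0 by linarith)]
        simp [this]
      · rw [lintegral_halfLinePow_mul_halfLinePow_sub p q hs, halfLinePow_of_pos hs]
        ring
    _ = _ := lintegral_mul_const _ (by fun_prop)

/-! ### Haar measure in polar coordinates -/

/-- In a real normed space of dimension `2 (p + 1)` the squared norm of a Haar distributed point
has density proportional to `a ^ p`. -/
theorem exists_lintegral_norm_sq_eq {E : Type*} [NormedAddCommGroup E] [NormedSpace ℝ E]
    [FiniteDimensional ℝ E] [MeasurableSpace E] [BorelSpace E] (μ : Measure E)
    [μ.IsAddHaarMeasure] {p : ℕ} (hE : finrank ℝ E = 2 * (p + 1)) :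
    ∃ c : ℝ≥0∞, ∀ g : ℝ → ℝ≥0∞, Measurable g →
      ∫⁻ x, g (‖x‖ ^ 2) ∂μ = c * ∫⁻ a, halfLinePow p a * g a := by
  have : Nontrivial E := Module.nontrivial_of_finrank_pos (R := ℝ) (by omega)
  refine ⟨μ.toSphere univ * 2⁻¹, fun g hg => ?_⟩
  have hsq : (fun r : ℝ => r ^ 2) '' Ioi 0 = Ioi 0 := by
    ext a
    constructor
    · rintro ⟨r, hr, rfl⟩
      exact pow_pos (mem_Ioi.1 hr) 2
    · intro ha
      exact ⟨√a, Real.sqrt_pos.2 ha, Real.sq_sqrt (le_of_lt ha)⟩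
  have key := lintegral_image_eq_lintegral_abs_deriv_mul (s := Ioi 0) (f := fun r : ℝ => r ^ 2)
    (f' := fun r => 2 * r) measurableSet_Ioi
    (fun x _ => by simpa using (hasDerivAt_pow 2 x).hasDerivWithinAt)
    (fun x hx y hy h => (pow_left_inj₀ (le_of_lt hx) (le_of_lt hy) two_ne_zero).1 h)
    (fun a => ENNReal.ofReal (a ^ p) * g a)
  rw [hsq] at key
  calc
    ∫⁻ x, g (‖x‖ ^ 2) ∂μ = ∫⁻ x : ({0}ᶜ : Set E), g (‖x.1‖ ^ 2) ∂(μ.comap (↑)) := by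
      rw [lintegral_subtype_comap (measurableSet_singleton _).compl fun x => g (‖x‖ ^ 2),
        restrict_compl_singleton]
    _ = ∫⁻ x, g (x.2.1 ^ 2) ∂μ.toSphere.prod (.volumeIoiPow (finrank ℝ E - 1)) := by
      rw [← μ.measurePreserving_homeomorphUnitSphereProd.lintegral_comp (by fun_prop)]
      simp
    _ = μ.toSphere univ * ∫⁻ r : Ioi (0 : ℝ), g (r.1 ^ 2) ∂.volumeIoiPow (finrank ℝ E - 1) := by
      rw [lintegral_prod _ (by fun_prop)]
      simp [mul_comm]
    _ = μ.toSphere univ * ∫⁻ r in Ioi (0 : ℝ), ENNReal.ofReal (r ^ (2 * p + 1)) * g (r ^ 2) := by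
      rw [Measure.volumeIoiPow, lintegral_withDensity_eq_lintegral_mul _ (by fun_prop)
        (by fun_prop), ← lintegral_subtype_comap measurableSet_Ioi,
        show finrank ℝ E - 1 = 2 * p + 1 by omega]
      rfl
    _ = _ := by
      rw [lintegral_halfLinePow_mul, key, mul_assoc,
        ← lintegral_const_mul' 2⁻¹ _ (by simp)]
      congr 1
      refine setLIntegral_congr_fun measurableSet_Ioi fun r hr => ?_
      have hr : 0 < r := hr
      rw [abs_of_pos (by positivity), ENNReal.ofReal_mul zero_le_two, ENNReal.ofReal_ofNat,
        mul_assoc, ← mul_assoc 2⁻¹, ENNReal.inv_mul_cancel two_ne_zero ENNReal.ofNat_ne_top,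
        one_mul, ← mul_assoc, ← ENNReal.ofReal_mul hr.le]
      congr 2
      ring

/-- The law of a scale-invariant function of the direction of a point is its law for a uniform
point of the unit ball. -/
theorem toSphere_preimage_eq {E : Type*} [NormedAddCommGroup E] [NormedSpace ℝ E]
    [Nontrivial E] [MeasurableSpace E] [BorelSpace E]
    [FiniteDimensional ℝ E] (μ : Measure E) [μ.IsAddHaarMeasure] {S : Set E}
    (hS : MeasurableSet S) (hcone : ∀ r : ℝ, 0 < r → ∀ x, r • x ∈ S ↔ x ∈ S) :
    μ.toSphere ((↑) ⁻¹' S) = finrank ℝ E * μ (ball 0 1 ∩ S) := by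
  rw [μ.toSphere_apply' (measurable_subtype_coe hS)]
  congr 1
  have : Ioo (0 : ℝ) 1 • ((↑) '' ((↑) ⁻¹' S : Set (sphere (0 : E) 1))) =
      (ball 0 1 ∩ S) \ {0} := by
    ext x
    constructor
    · rintro ⟨r, hr, _, ⟨u, hu, rfl⟩, rfl⟩
      have hu1 : ‖(u : E)‖ = 1 := norm_eq_of_mem_sphere u
      refine ⟨⟨?_, (hcone r hr.1 _).2 hu⟩, ?_⟩
      · simpa [norm_smul, hu1, abs_of_pos hr.1] using hr.2
      · have : (u : E) ≠ 0 := norm_ne_zero_iff.1 (by simp [hu1])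
        simpa [hr.1.ne'] using this
    · rintro ⟨⟨hx1, hxS⟩, hx0⟩
      have hx : 0 < ‖x‖ := norm_pos_iff.2 hx0
      refine ⟨‖x‖, ⟨hx, by simpa using hx1⟩, ‖x‖⁻¹ • x,
        ⟨⟨‖x‖⁻¹ • x, by simp [norm_smul, hx.ne']⟩, ?_, rfl⟩, ?_⟩
      · exact (hcone _ (inv_pos.2 hx) x).2 hxS
      · simp [smul_smul, hx.ne']
  rw [this, measure_sdiff_null (measure_singleton _)]

/-! ### Splitting a uniform unit vector -/

theorem betaMeasure_eq_withDensity (p q : ℕ) :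
    betaMeasure ((p + 1 : ℕ) : ℝ) ((q + 1 : ℕ) : ℝ) =
      ENNReal.ofReal (1 / beta ((p + 1 : ℕ) : ℝ) ((q + 1 : ℕ) : ℝ)) •
        volume.withDensity fun r => halfLinePow p r * halfLinePow q (1 - r) := by
  have hp := measurable_halfLinePow p
  have hq := measurable_halfLinePow q
  have hb : 0 < beta ((p + 1 : ℕ) : ℝ) ((q + 1 : ℕ) : ℝ) := beta_pos (by positivity) (by positivity)
  rw [betaMeasure, ← withDensity_smul _ (by fun_prop)]
  congr 1
  ext r
  rw [Pi.smul_apply, smul_eq_mul]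
  rcases le_or_gt r 0 with hr | hr
  · simp [betaPDF_eq_zero_of_nonpos hr, halfLinePow_of_nonpos hr]
  rcases le_or_gt (1 - r) 0 with hr' | hr'
  · rw [betaPDF_eq_zero_of_one_le (by linarith), halfLinePow_of_nonpos hr']
    simp
  rw [betaPDF_of_pos_lt_one hr (by linarith), halfLinePow_of_pos hr, halfLinePow_of_pos hr',
    ← ENNReal.ofReal_mul (by positivity), ← ENNReal.ofReal_mul (by positivity)]
  simp [mul_assoc]

/-- Let `Φ` split a normed space into two factors of real dimensions `2 (p + 1)` and `2 (q + 1)`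
with `‖x‖ ^ 2 = ‖(Φ x).1‖ ^ 2 + ‖(Φ x).2‖ ^ 2`. The proportion of the squared norm of a uniform unit
vector that lies in the first factor has the Beta distribution with parameters
`p + 1` and `q + 1`. -/
theorem map_toSphere_norm_sq_fst {E A B : Type*}
    [NormedAddCommGroup E] [NormedSpace ℝ E] [FiniteDimensional ℝ E] [MeasurableSpace E]
    [BorelSpace E] [NormedAddCommGroup A] [NormedSpace ℝ A] [FiniteDimensional ℝ A]
    [MeasurableSpace A] [BorelSpace A] [NormedAddCommGroup B] [NormedSpace ℝ B]
    [FiniteDimensional ℝ B] [MeasurableSpace B] [BorelSpace B]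
    (μ : Measure E) [μ.IsAddHaarMeasure] (Φ : E ≃L[ℝ] A × B)
    (hΦ : ∀ x, ‖x‖ ^ 2 = ‖(Φ x).1‖ ^ 2 + ‖(Φ x).2‖ ^ 2) {p q : ℕ}
    (hA : finrank ℝ A = 2 * (p + 1)) (hB : finrank ℝ B = 2 * (q + 1)) :
    ((μ.toSphere univ)⁻¹ • μ.toSphere).map (fun u => ‖(Φ u.1).1‖ ^ 2) =
      betaMeasure ((p + 1 : ℕ) : ℝ) ((q + 1 : ℕ) : ℝ) := by
  have : Nontrivial A := Module.nontrivial_of_finrank_pos (R := ℝ) (by omega)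
  have : Nontrivial E := Φ.toEquiv.nontrivial
  obtain ⟨cA, hcA⟩ := exists_lintegral_norm_sq_eq (Measure.addHaar : Measure A) hA
  obtain ⟨cB, hcB⟩ := exists_lintegral_norm_sq_eq (Measure.addHaar : Measure B) hB
  have hfst : Measurable fun u : sphere (0 : E) 1 => ‖(Φ u.1).1‖ ^ 2 :=
    Continuous.measurable (by fun_prop)
  have hΦm : Measurable Φ := Φ.continuous.measurable
  have hp := measurable_halfLinePow p
  have hq := measurable_halfLinePow q
  -- As a function of the squared norm, `w` is the indicator of the unit ball.
  set w : ℝ → ℝ≥0∞ := (Iio 1).indicator 1 with hwdef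
  have hw : Measurable w := measurable_one.indicator measurableSet_Iio
  have hprod : μ.map Φ = ((μ.map Φ).addHaarScalarFactor
      ((Measure.addHaar : Measure A).prod (Measure.addHaar : Measure B))) •
      ((Measure.addHaar : Measure A).prod (Measure.addHaar : Measure B)) :=
    Measure.isAddLeftInvariant_eq_smul _ _
  set c := (μ.map Φ).addHaarScalarFactor
      ((Measure.addHaar : Measure A).prod (Measure.addHaar : Measure B))
  have hball : ∀ T : Set ℝ, MeasurableSet T →
      μ (ball 0 1 ∩ {x | ‖(Φ x).1‖ ^ 2 / ‖x‖ ^ 2 ∈ T}) =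
        c * (cA * (cB * ((∫⁻ s, halfLinePow (p + q + 1) s * w s) *
          ∫⁻ r, halfLinePow p r * halfLinePow q (1 - r) * T.indicator 1 r))) := by
    intro T hT
    have hφ : Measurable (T.indicator (1 : ℝ → ℝ≥0∞)) := measurable_one.indicator hT
    have hS : MeasurableSet {x : E | ‖(Φ x).1‖ ^ 2 / ‖x‖ ^ 2 ∈ T} :=
      (show Measurable fun x : E => ‖(Φ x).1‖ ^ 2 / ‖x‖ ^ 2 by fun_prop) hT
    calc
      _ = ∫⁻ x, w (‖(Φ x).1‖ ^ 2 + ‖(Φ x).2‖ ^ 2) *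
            T.indicator 1 (‖(Φ x).1‖ ^ 2 / (‖(Φ x).1‖ ^ 2 + ‖(Φ x).2‖ ^ 2)) ∂μ := by
        rw [← lintegral_indicator_one (measurableSet_ball.inter hS)]
        refine lintegral_congr fun x => ?_
        rw [← hΦ, inter_indicator_one, Pi.mul_apply]
        congr 1
        classical
        simp only [hwdef, indicator_apply, mem_ball_zero_iff, mem_Iio, Pi.one_apply,
          sq_lt_one_iff₀ (norm_nonneg x)]
      _ = ∫⁻ y, w (‖y.1‖ ^ 2 + ‖y.2‖ ^ 2) *
            T.indicator 1 (‖y.1‖ ^ 2 / (‖y.1‖ ^ 2 + ‖y.2‖ ^ 2)) ∂(μ.map Φ) := by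
        rw [lintegral_map (by fun_prop) hΦm]
      _ = c * ∫⁻ a : A, ∫⁻ b : B, w (‖a‖ ^ 2 + ‖b‖ ^ 2) *
            T.indicator 1 (‖a‖ ^ 2 / (‖a‖ ^ 2 + ‖b‖ ^ 2))
              ∂Measure.addHaar ∂Measure.addHaar := by
        rw [hprod, lintegral_smul_measure, lintegral_prod _ (by fun_prop)]
        rfl
      _ = c * ∫⁻ a : A, (cB * ∫⁻ b, halfLinePow q b *
            (w (‖a‖ ^ 2 + b) * T.indicator 1 (‖a‖ ^ 2 / (‖a‖ ^ 2 + b)))) ∂Measure.addHaar := by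
        congr 1
        refine lintegral_congr fun a => ?_
        exact hcB (fun b => w (‖a‖ ^ 2 + b) * T.indicator 1 (‖a‖ ^ 2 / (‖a‖ ^ 2 + b)))
          (by fun_prop)
      _ = c * (cA * ∫⁻ a, halfLinePow p a * (cB * ∫⁻ b, halfLinePow q b *
            (w (a + b) * T.indicator 1 (a / (a + b))))) := by
        congr 1
        refine hcA (fun a => cB * ∫⁻ b, halfLinePow q b *
            (w (a + b) * T.indicator 1 (a / (a + b)))) ?_
        refine Measurable.const_mul (Measurable.lintegral_prod_right' (f := fun z : ℝ × ℝ =>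
          halfLinePow q z.2 * (w (z.1 + z.2) * T.indicator 1 (z.1 / (z.1 + z.2)))) ?_) _
        fun_prop
      _ = _ := by
        rw [← lintegral_lintegral_halfLinePow p q hw hφ, ← lintegral_const_mul cB]
        · simp only [mul_left_comm cB]
        · refine Measurable.mul hp (Measurable.lintegral_prod_right' (f := fun z : ℝ × ℝ =>
            halfLinePow q z.2 * (w (z.1 + z.2) * T.indicator 1 (z.1 / (z.1 + z.2)))) ?_)
          fun_prop
  have hb : 0 < beta ((p + 1 : ℕ) : ℝ) ((q + 1 : ℕ) : ℝ) := beta_pos (by positivity) (by positivity)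
  obtain ⟨C, hC⟩ : ∃ C : ℝ≥0∞,
      ((μ.toSphere univ)⁻¹ • μ.toSphere).map (fun u => ‖(Φ u.1).1‖ ^ 2) =
        C • betaMeasure ((p + 1 : ℕ) : ℝ) ((q + 1 : ℕ) : ℝ) := by
    refine ⟨(μ.toSphere univ)⁻¹ * (finrank ℝ E * (c * (cA * (cB *
      ((∫⁻ s, halfLinePow (p + q + 1) s * w s) *
        ENNReal.ofReal (beta ((p + 1 : ℕ) : ℝ) ((q + 1 : ℕ) : ℝ))))))), ?_⟩
    ext T hT
    have hS : MeasurableSet {x : E | ‖(Φ x).1‖ ^ 2 / ‖x‖ ^ 2 ∈ T} :=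
      (show Measurable fun x : E => ‖(Φ x).1‖ ^ 2 / ‖x‖ ^ 2 by fun_prop) hT
    have hpre : (fun u : sphere (0 : E) 1 => ‖(Φ u.1).1‖ ^ 2) ⁻¹' T =
        (↑) ⁻¹' {x : E | ‖(Φ x).1‖ ^ 2 / ‖x‖ ^ 2 ∈ T} := by
      ext u
      simp
    have hone : ENNReal.ofReal (beta ((p + 1 : ℕ) : ℝ) ((q + 1 : ℕ) : ℝ)) *
        ENNReal.ofReal (1 / beta ((p + 1 : ℕ) : ℝ) ((q + 1 : ℕ) : ℝ)) = 1 := by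
      rw [← ENNReal.ofReal_mul hb.le, mul_one_div_cancel hb.ne', ENNReal.ofReal_one]
    have hint : ∫⁻ r, halfLinePow p r * halfLinePow q (1 - r) * T.indicator 1 r =
        ∫⁻ r in T, halfLinePow p r * halfLinePow q (1 - r) := by
      rw [← lintegral_indicator hT]
      refine lintegral_congr fun r => ?_
      by_cases hr : r ∈ T <;> simp [hr]
    rw [Measure.map_apply hfst hT, hpre, Measure.smul_apply, smul_eq_mul,
      toSphere_preimage_eq μ hS ?_, hball T hT, Measure.smul_apply, betaMeasure_eq_withDensity,
      Measure.smul_apply, withDensity_apply _ hT, hint, smul_eq_mul, smul_eq_mul]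
    · simp only [mul_assoc]
      rw [← mul_assoc (ENNReal.ofReal (beta _ _)), hone, one_mul]
    · intro r hr x
      have : ‖(Φ (r • x)).1‖ ^ 2 / ‖r • x‖ ^ 2 = ‖(Φ x).1‖ ^ 2 / ‖x‖ ^ 2 := by
        simp only [map_smul, Prod.smul_fst, norm_smul, mul_pow]
        exact mul_div_mul_left _ _ (by simp [hr.ne'])
      simp only [mem_ofPred_eq, this]
  have := isProbabilityMeasureBeta (α := ((p + 1 : ℕ) : ℝ)) (β := ((q + 1 : ℕ) : ℝ))
    (by positivity) (by positivity)
  -- Comparing total masses gives `C = 1`.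
  have hmass := congrArg (fun ν => ν univ) hC
  simp only [Measure.map_apply hfst MeasurableSet.univ, preimage_univ, Measure.smul_apply,
    smul_eq_mul, measure_univ, mul_one] at hmass
  rw [ENNReal.inv_mul_cancel (by
    simpa only [ne_eq, Measure.measure_univ_eq_zero] using μ.toSphere_ne_zero)
    (measure_ne_top _ _)] at hmass
  rw [hC, ← hmass, one_smul]

/-! ### Components of a random pure state -/

/-- For an isometric embedding `J` of `ℂ^κ` into `ℂ^ι`, the map `ξ ↦ (J† ξ, ξ - J J† ξ)` splits
`ℂ^ι` into `ℂ^κ` and the orthogonal complement of the range of `J`, written as the kernel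
of `J†`. -/
noncomputable def isometrySplitting {ι κ : Type*} [Fintype ι] [Fintype κ]
    (J : EuclideanSpace ℂ κ →ₗᵢ[ℂ] EuclideanSpace ℂ ι) :
    EuclideanSpace ℂ ι ≃ₗ[ℂ] EuclideanSpace ℂ κ ×
      LinearMap.ker (ContinuousLinearMap.adjoint J.toContinuousLinearMap).toLinearMap :=
  have hJ (v : EuclideanSpace ℂ κ) :
      ContinuousLinearMap.adjoint J.toContinuousLinearMap (J v) = v :=
    congrArg (fun S => S v) J.adjoint_comp_self
  LinearEquiv.ofLinearMap
    (LinearMap.prod (ContinuousLinearMap.adjoint J.toContinuousLinearMap).toLinearMap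
      (LinearMap.codRestrict _
        (LinearMap.id - J.toLinearMap ∘ₗ
          (ContinuousLinearMap.adjoint J.toContinuousLinearMap).toLinearMap)
        fun ξ => by simp [hJ]))
    (LinearMap.coprod J.toLinearMap (Submodule.subtype _))
    (by
      refine LinearMap.ext fun ⟨v, w, hw⟩ => ?_
      have hw : ContinuousLinearMap.adjoint J.toContinuousLinearMap w = 0 := hw
      ext <;> simp [hJ, hw])
    (by
      refine LinearMap.ext fun ξ => ?_
      simp)

theorem isometrySplitting_fst {ι κ : Type*} [Fintype ι] [Fintype κ]
    (J : EuclideanSpace ℂ κ →ₗᵢ[ℂ] EuclideanSpace ℂ ι) (ξ : EuclideanSpace ℂ ι) :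
    (isometrySplitting J ξ).1 = ContinuousLinearMap.adjoint J.toContinuousLinearMap ξ :=
  rfl

theorem norm_sq_eq_isometrySplitting {ι κ : Type*} [Fintype ι] [Fintype κ]
    (J : EuclideanSpace ℂ κ →ₗᵢ[ℂ] EuclideanSpace ℂ ι) (ξ : EuclideanSpace ℂ ι) :
    ‖ξ‖ ^ 2 = ‖(isometrySplitting J ξ).1‖ ^ 2 + ‖(isometrySplitting J ξ).2‖ ^ 2 := by
  obtain ⟨⟨v, w, hw⟩, rfl⟩ := (isometrySplitting J).symm.surjective ξ
  have hw : ContinuousLinearMap.adjoint J.toContinuousLinearMap w = 0 := hw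
  rw [LinearEquiv.apply_symm_apply]
  change ‖J v + w‖ ^ 2 = ‖v‖ ^ 2 + ‖w‖ ^ 2
  have horth : ⟪J v, w⟫_ℂ = 0 := by
    have := ContinuousLinearMap.adjoint_inner_right J.toContinuousLinearMap v w
    rw [hw, inner_zero_right] at this
    exact this.symm
  have := norm_add_sq_eq_norm_sq_add_norm_sq_of_inner_eq_zero (𝕜 := ℂ) (J v) w horth
  rw [J.norm_map] at this
  simpa only [sq] using this

/-- The squared norm of the component of a random pure state along an isometrically embedded
copy of `ℂ^κ` has a Beta distribution whose parameters are the two complex dimensions. -/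
theorem map_randomPureState_norm_adjoint_sq {ι κ : Type*} [Fintype ι] [Fintype κ]
    (J : EuclideanSpace ℂ κ →ₗᵢ[ℂ] EuclideanSpace ℂ ι) {p q : ℕ}
    (hκ : Fintype.card κ = p + 1) (hι : Fintype.card ι = (p + 1) + (q + 1)) :
    (randomPureState ι).map
        (fun ξ => ‖ContinuousLinearMap.adjoint J.toContinuousLinearMap ξ.1‖ ^ 2) =
      betaMeasure ((p + 1 : ℕ) : ℝ) ((q + 1 : ℕ) : ℝ) := by
  have hA : finrank ℝ (EuclideanSpace ℂ κ) = 2 * (p + 1) := by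
    rw [← finrank_mul_finrank ℝ ℂ, Complex.finrank_real_complex, finrank_euclideanSpace, hκ]
  have hB : finrank ℝ (LinearMap.ker
      (ContinuousLinearMap.adjoint J.toContinuousLinearMap).toLinearMap) = 2 * (q + 1) := by
    rw [← finrank_mul_finrank ℝ ℂ, Complex.finrank_real_complex]
    have := (isometrySplitting J).finrank_eq
    rw [finrank_prod, finrank_euclideanSpace, finrank_euclideanSpace, hκ, hι] at this
    omega
  exact map_toSphere_norm_sq_fst (volume : Measure (EuclideanSpace ℂ ι))
    ((isometrySplitting J).restrictScalars ℝ).toContinuousLinearEquiv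
    (norm_sq_eq_isometrySplitting J) hA hB

/-! ### Expectation values of reduced states -/

/-- The isometric embedding `v ↦ x ⊗ v` of `ℂ^κ` into `ℂ^ι ⊗ ℂ^κ = ℂ^(ι × κ)` given by a unit
vector `x` of `ℂ^ι`. -/
noncomputable def tensorIsometry {ι : Type*} (κ : Type*) [Fintype ι] [Fintype κ]
    (x : UnitVector ι) : EuclideanSpace ℂ κ →ₗᵢ[ℂ] EuclideanSpace ℂ (ι × κ) where
  toFun v := WithLp.toLp 2 fun p => x.1 p.1 * v p.2
  map_add' v w := by
    ext p
    simp [mul_add]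
  map_smul' c v := by
    ext p
    simp [mul_left_comm]
  norm_map' v := by
    have hx : ∑ i, ‖x.1 i‖ ^ 2 = 1 := by
      rw [← EuclideanSpace.norm_sq_eq, norm_eq_of_mem_sphere x, one_pow]
    rw [← sq_eq_sq₀ (norm_nonneg _) (norm_nonneg _), EuclideanSpace.norm_sq_eq,
      EuclideanSpace.norm_sq_eq, Fintype.sum_prod_type]
    simp only [LinearMap.coe_mk, AddHom.coe_mk, norm_mul, mul_pow, ← Finset.mul_sum]
    rw [← Finset.sum_mul, hx, one_mul]

theorem adjoint_tensorIsometry_apply {ι κ : Type*} [Fintype ι] [Fintype κ]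
    (x : UnitVector ι) (ξ : EuclideanSpace ℂ (ι × κ)) (k : κ) :
    ContinuousLinearMap.adjoint (tensorIsometry κ x).toContinuousLinearMap ξ k =
      ∑ i, star (x.1 i) * ξ (i, k) := by
  classical
  have h := ContinuousLinearMap.adjoint_inner_right (tensorIsometry κ x).toContinuousLinearMap
    (EuclideanSpace.single k 1) ξ
  rw [EuclideanSpace.inner_single_left, map_one, one_mul] at h
  rw [h, PiLp.inner_apply, Fintype.sum_prod_type]
  refine Finset.sum_congr rfl fun i _ => ?_
  rw [Finset.sum_eq_single k]
  · simp [tensorIsometry, mul_comm]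
  · intro j _ hj
    simp [tensorIsometry, hj]
  · simp

/-- If `σ = Tr_κ |ξ⟩⟨ξ|`, then `⟨x|σ|x⟩` is the squared norm of the component of `ξ` in
`x ⊗ ℂ^κ`. -/
theorem expectationValue_reducedState {ι κ : Type*} [Fintype ι] [Fintype κ]
    (ξ : UnitVector (ι × κ)) (x : UnitVector ι) :
    expectationValue (reducedState ξ).1 x =
      ((‖ContinuousLinearMap.adjoint (tensorIsometry κ x).toContinuousLinearMap ξ.1‖ ^ 2 : ℝ) :
        ℂ) := by
  rw [EuclideanSpace.norm_sq_eq]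
  push_cast
  simp only [adjoint_tensorIsometry_apply, ← Complex.mul_conj', map_sum, Finset.sum_mul_sum]
  simp only [expectationValue, reducedState, partialTrace, pureProjector, dotProduct,
    Matrix.mulVec, Matrix.of_apply, Matrix.vecMulVec_apply, Pi.star_apply, Finset.mul_sum,
    Finset.sum_mul]
  rw [Finset.sum_comm (s := (Finset.univ : Finset κ))]
  refine Finset.sum_congr rfl fun i _ => ?_
  rw [Finset.sum_comm (s := (Finset.univ : Finset κ))]
  refine Finset.sum_congr rfl fun j _ => Finset.sum_congr rfl fun k _ => ?_
  simp
  ring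

theorem measurable_expectationValue_left {ι : Type*} [Fintype ι] (x : UnitVector ι) :
    Measurable fun A : Matrix ι ι ℂ => expectationValue A x :=
  measurable_expectationValue.comp
    (f := fun A : Matrix ι ι ℂ => (A, x)) measurable_prodMk_right

/-- The unit vector `x` may be held fixed: the law of `⟨x|σ|x⟩` for a random `σ` does not depend
on it. -/
theorem map_inducedMeasure_expectationValue {N K p q : ℕ} (hK : K = p + 1)
    (hN : K * (N - 1) = q + 1) (x : UnitVector (Fin N)) :
    (inducedMeasure N K).map (fun σ => expectationValue σ.1 x) =
      (betaMeasure (K : ℝ) ((K * (N - 1) : ℕ) : ℝ)).map (fun r : ℝ => (r : ℂ)) := by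
  have hN0 : N ≠ 0 := by
    rintro rfl
    simp at hN
  have hcard : N * K = (p + 1) + (q + 1) := by
    obtain ⟨n, rfl⟩ := Nat.exists_eq_succ_of_ne_zero hN0
    rw [← hN, ← hK, Nat.succ_sub_one, Nat.succ_mul]
    ring
  have hσ : Measurable fun σ : DensityMatrix (Fin N) => expectationValue σ.1 x :=
    (measurable_expectationValue_left x).comp measurable_subtype_coe
  subst hK
  rw [inducedMeasure, Measure.map_map hσ measurable_reducedState,
    hN, ← map_randomPureState_norm_adjoint_sq (tensorIsometry (Fin (p + 1)) x)
      (by simp) (q := q) (by simp [hcard]), Measure.map_map (by fun_prop)]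
  · congr 1
    ext ξ
    exact expectationValue_reducedState ξ x
  · exact Continuous.measurable (by fun_prop)

theorem betaMeasure_eq_restrict_Icc_withDensity {a b : ℕ} (ha : 1 ≤ a) (hb : 1 ≤ b) :
    betaMeasure (a : ℝ) (b : ℝ) =
      (volume.restrict (Icc (0 : ℝ) 1)).withDensity (fun r : ℝ => ENNReal.ofReal
        (1 / beta (a : ℝ) (b : ℝ) * (r ^ (a - 1) * (1 - r) ^ (b - 1)))) := by
  rw [← restrict_Ioo_eq_restrict_Icc, betaMeasure, ← withDensity_indicator measurableSet_Ioo]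
  congr 1
  ext r
  by_cases hr : r ∈ Ioo (0 : ℝ) 1
  · rw [indicator_of_mem hr, betaPDF_of_pos_lt_one hr.1 hr.2, mul_assoc,
      ← Nat.cast_pred (by omega), ← Nat.cast_pred (by omega), Real.rpow_natCast, Real.rpow_natCast]
  · rw [indicator_of_notMem hr, betaPDF_eq, if_neg (by exact hr), ENNReal.ofReal_zero]

theorem mainTheorem4 (N K : ℕ) (hN : 2 ≤ N) (hK : 1 ≤ K) :
    -- the shadow of the random density matrix is the Beta distribution (on `[0,1] ⊆ ℂ`)
    randomNumericalShadow ((inducedMeasure N K).map Subtype.val) =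
        (ProbabilityTheory.betaMeasure (K : ℝ) (((K * (N - 1) : ℕ)) : ℝ)).map
          (fun r : ℝ => (r : ℂ)) ∧
    -- so is the law of every diagonal entry
    (∀ i : Fin N,
      (inducedMeasure N K).map (fun σ : DensityMatrix (Fin N) => σ.1 i i) =
        (ProbabilityTheory.betaMeasure (K : ℝ) (((K * (N - 1) : ℕ)) : ℝ)).map
          (fun r : ℝ => (r : ℂ))) ∧
    -- the explicit density on `[0,1]`
    randomNumericalShadow ((inducedMeasure N K).map Subtype.val) =
      ((volume.restrict (Set.Icc (0 : ℝ) 1)).withDensity (fun r : ℝ => ENNReal.ofReal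
        (1 / ProbabilityTheory.beta (K : ℝ) (((K * (N - 1) : ℕ)) : ℝ) *
          (r ^ (K - 1) * (1 - r) ^ (K * (N - 1) - 1))))).map (fun r : ℝ => (r : ℂ)) := by
  have hKN : 1 ≤ K * (N - 1) := Nat.mul_pos hK (by omega)
  obtain ⟨p, hp⟩ := Nat.exists_eq_add_of_le' hK
  obtain ⟨q, hq⟩ := Nat.exists_eq_add_of_le' hKN
  have : Nonempty (Fin N) := ⟨⟨0, by omega⟩⟩
  have hshadow : randomNumericalShadow ((inducedMeasure N K).map Subtype.val) =
      (betaMeasure (K : ℝ) ((K * (N - 1) : ℕ) : ℝ)).map (fun r : ℝ => (r : ℂ)) := by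
    have : IsFiniteMeasure (inducedMeasure N K) := by
      rw [inducedMeasure]
      infer_instance
    ext S hS
    rw [randomNumericalShadow, ← Measure.prod_swap, Measure.map_map measurable_expectationValue
      measurable_swap]
    have h := map_prod_apply_eq_lintegral (randomPureState (Fin N))
      ((inducedMeasure N K).map Subtype.val) (f := fun x A => expectationValue A x)
      (measurable_expectationValue.comp measurable_swap) hS
    refine h.trans ?_
    have hx : ∀ x : UnitVector (Fin N),
        ((inducedMeasure N K).map Subtype.val).map (fun A => expectationValue A x) =
          (betaMeasure (K : ℝ) ((K * (N - 1) : ℕ) : ℝ)).map (fun r : ℝ => (r : ℂ)) := fun x => by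
      rw [Measure.map_map (measurable_expectationValue_left x) measurable_subtype_coe]
      exact map_inducedMeasure_expectationValue hp hq x
    simp [hx]
  refine ⟨hshadow, fun i => ?_, ?_⟩
  · rw [← map_inducedMeasure_expectationValue hp hq
      ⟨EuclideanSpace.single i 1, by simp⟩]
    congr 1
    ext σ
    simp [expectationValue, dotProduct, Matrix.mulVec]
  · rw [hshadow, betaMeasure_eq_restrict_Icc_withDensity hK hKN]
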